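/- Let $\Omega\subset\mathbb R^2$ be compact, with boundary $\partial\Omega$ a simple closed piecewise $C^1$ curve of length $L>0$, and let $\gamma$ be an arclength parametrization of $\partial\Omega$ which keeps the interior of $\Omega$ on its left; $\gamma$ is regarded as an $L$-periodic map $\mathbb R\to\mathbb R^2$ that is injective on $[0,L)$. For $p\in\mathbb R^2$ and $r>0$ let $D(p,r)$ and $C(p,r)$ be the closed disk and the circle of radius $r$ about $p$, and put $$g(s,r)=\operatorname{area}\bigl(\Omega\cap D(\gamma(s),r)\bigr).$$ The tangent cone of $\gamma$ at $t$ is $T_\gamma(t)=\{\alpha\Gamma^-+\beta\Gamma^+:\alpha,\beta\ge 0,\ \alpha+\beta>0\}$, where $\Gamma^{-}=\lim_{u\uparrow t}\gamma'(u)$ and $\Gamma^{+}=\lim_{u\downarrow t}\gamma'(u)$. The boundary $\partial\Omega$ is tangent-cone graph-like with radius $r$ if for all $t$, all $w\in T_\gamma(t)$ and all distinct $u,v\in\partial\Omega\cap D(\gamma(t),r)$ one has $\langle w,u-v\rangle\ne 0$. It is tangentially graph-like at $\gamma(s)$ with radius $r$ if $\gamma$ is differentiable at $s$ and, in the Cartesian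 coordinates with origin $\gamma(s)$, first axis along $T=\gamma'(s)$ and second axis along the left normal $N$ ($T$ rotated by $+\pi/2$), the set $\partial\Omega\cap D(\gamma(s),r)$ is the graph of a function $f$ (defined on a set of reals) with $f(0)=0$ and $f'(0)=0$. Let $r>0$ and $s\in[0,L)$ be such that $\partial\Omega$ is tangent-cone graph-like with radius $r$ and tangentially graph-like at $\gamma(s)$ with radius $r$. Then there are parameters $s^-<s<s^+<s^-+L$ with $\gamma([s^-,s^+])\subset D(\gamma(s),r)$ and $\partial\Omega\cap C(\gamma(s),r)=\{\gamma(s^+),\gamma(s^-)\}$, and angles $\theta_1\in(-\frac{\pi}{2},\frac{\pi}{2})$, $\theta_2\in(\frac{\pi}{2},\frac{3\pi}{2})$ with $$\gamma(s^+)=\gamma(s)+r(\cos\theta_1\,T+\sin\theta_1\,N),\qquad \gamma(s^-)=\gamma(s)+r(\cos\theta_2\,T+\sin\theta_2\,N),$$ and the partial derivative of $g$ with respect to $s$ exists at $(s,r)$ and equals $$\frac{\partial g}{\partial s}(s,r)=r\sin\theta_2-r\sin\theta_1=\langle N,\gamma(s^-)-\gamma(s)\rangle-\langle N,\gamma(s^+)-\gamma(s)\rangle,$$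 the height of the entry point $\gamma(s^-)$ minus the height of the exit point $\gamma(s^+)$, measured in the tangent frame at $\gamma(s)$. -/

import Mathlib

open Set Filter Topology MeasureTheory

/-- The Euclidean plane. -/
abbrev Plane : Type := EuclideanSpace ℝ (Fin 2)

/-- Counterclockwise rotation by a quarter turn. -/
def rotLeft (v : Plane) : Plane := !₂[-(v 1), v 0]

/-- `γ` is continuously differentiable on each of finitely many consecutive closed intervals
that make up `[0, L]` (with one-sided derivatives at their end points). -/
def PiecewiseC1 (γ : ℝ → Plane) (L : ℝ) : Prop :=
  ∃ (n : ℕ) (τ : Fin (n + 1) → ℝ), StrictMono τ ∧ τ 0 = 0 ∧ τ (Fin.last n) = L ∧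
    ∀ i : Fin n, ContDiffOn ℝ 1 γ (Icc (τ i.castSucc) (τ i.succ))

/-- `Ω` is a compact plane set whose boundary is a simple closed, piecewise `C¹` curve of
length `L`, and `γ` is an arclength parametrization of this boundary that keeps the interior of
`Ω` on its left. A closed curve on `[0, L]` is represented by its `L`-periodic extension
to `ℝ`, so that every parameter has neighbours on both sides. -/
structure IsBoundaryParam (Ω : Set Plane) (γ : ℝ → Plane) (L : ℝ) : Prop where
  isCompact : IsCompact Ω
  length_pos : 0 < L
  continuous : Continuous γ
  periodic : Function.Periodic γ L
  injOn : InjOn γ (Ico 0 L)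
  image_eq : γ '' Ico 0 L = frontier Ω
  piecewiseC1 : PiecewiseC1 γ L
  unit_speed : ∀ t, DifferentiableAt ℝ γ t → ‖deriv γ t‖ = 1
  interior_left : ∀ t, DifferentiableAt ℝ γ t →
    ∀ᶠ ε : ℝ in 𝓝[>] 0, γ t + ε • rotLeft (deriv γ t) ∈ interior Ω

/-- The integral area invariant `g(s, r)`: the area of the part of `Ω` in the closed disk of
radius `r` about `γ s`. -/
noncomputable def areaInvariant (Ω : Set Plane) (γ : ℝ → Plane) (s r : ℝ) : ℝ :=
  (volume (Ω ∩ Metric.closedBall (γ s) r)).toReal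

/-- The tangent cone of `γ` at `s`: all `α Γ⁻ + β Γ⁺` with `α, β ≥ 0` and `α + β > 0`, where
`Γ⁻` and `Γ⁺` are the left and right limits of `γ'` at `s`. -/
def curveTangentCone (γ : ℝ → Plane) (s : ℝ) : Set Plane :=
  {w | ∃ (Γm Γp : Plane) (α β : ℝ),
    Tendsto (deriv γ) (𝓝[<] s) (𝓝 Γm) ∧ Tendsto (deriv γ) (𝓝[>] s) (𝓝 Γp) ∧
    0 ≤ α ∧ 0 ≤ β ∧ 0 < α + β ∧ w = α • Γm + β • Γp}

/-- The boundary of `Ω` is tangent-cone graph-like at `γ s` with radius `r`. -/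
def IsTCGLAt (Ω : Set Plane) (γ : ℝ → Plane) (r s : ℝ) : Prop :=
  ∀ w ∈ curveTangentCone γ s,
    ∀ u ∈ frontier Ω ∩ Metric.closedBall (γ s) r, ∀ v ∈ frontier Ω ∩ Metric.closedBall (γ s) r,
      u ≠ v → inner ℝ w (u - v) ≠ 0

/-- The boundary of `Ω` is tangent-cone graph-like with radius `r` (at all of its points). -/
def IsTCGL (Ω : Set Plane) (γ : ℝ → Plane) (r : ℝ) : Prop :=
  ∀ s, IsTCGLAt Ω γ r s

/-- The boundary of `Ω` is tangentially graph-like at `γ s` with radius `r`: the curve has a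
tangent at `γ s`, and, in the Cartesian coordinates with origin `γ s`, first axis along `γ'(s)`
and second axis along its left normal, the part of the boundary in the closed disk of radius `r`
about `γ s` is the graph of a function `f` on a set `A` of reals, with `f 0 = 0` and `f' 0 = 0`. -/
def IsTGLAt (Ω : Set Plane) (γ : ℝ → Plane) (r s : ℝ) : Prop :=
  DifferentiableAt ℝ γ s ∧
  ∃ (A : Set ℝ) (f : ℝ → ℝ),
    frontier Ω ∩ Metric.closedBall (γ s) r =
      (fun x => γ s + x • deriv γ s + f x • rotLeft (deriv γ s)) '' A ∧
    0 ∈ A ∧ f 0 = 0 ∧ HasDerivWithinAt f 0 A 0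

/-- The point at angle `θ` on the circle of radius `r` about `γ s`, the angle being measured
counterclockwise from the tangent direction `γ'(s)`. -/
noncomputable def circlePoint (γ : ℝ → Plane) (r s θ : ℝ) : Plane :=
  γ s + r • (Real.cos θ • deriv γ s + Real.sin θ • rotLeft (deriv γ s))

/-- The height of a point `q` above the tangent line of `γ` at `s`. -/
noncomputable def tangentHeight (γ : ℝ → Plane) (s : ℝ) (q : Plane) : ℝ :=
  inner ℝ (rotLeft (deriv γ s)) (q - γ s)

/-! The first half of the proof finds how the circle meets `Ω`. At a local extremum of the distance
from `γ s` along the curve, the one-sided derivatives of the squared distance have opposite signs,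
so some vector of the tangent cone is orthogonal to the chord back to `γ s`. The tangent-cone
condition forbids this within distance `r` (`lt_dist_of_isLocalExtr`). Hence the curve leaves the
disk once in each direction and does not return in between (`exists_exit_params`). Since the
boundary in the disk is a graph over the tangent line, its exit point lies on the right half-circle
and its entry point on the left one. The vertical diameter meets the boundary only at `γ s`; its
upper end is inside `Ω` and its lower end outside. So each half-circle crosses from outside to
inside at a single height, `y₁` on the right and `y₂` on the left (`frame_arc`).

The second half differentiates. The area is Lipschitz in the centre of the disk, so the centre may
move along the tangent line instead of `γ` (`HasDerivAt.comp_curve_of_tangent_line`). On the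
horizontal slice at height `y` the disk cuts out a moving interval; the length of its part in `Ω`
changes at the rate 1 or 0 gained at the right end minus the rate 1 or 0 lost at the left end, that
is `1_{y > y₁} - 1_{y > y₂}`. Integration over `y` gives `(r - y₁) - (r - y₂) = y₂ - y₁`
(`hasDerivAt_volume_inter_disk`). -/

/-! ### One-sided derivatives and injectivity of the periodic curve -/

theorem exists_right_deriv_of_contDiffOn {E : Type*} [NormedAddCommGroup E] [NormedSpace ℝ E]
    {γ : ℝ → E} {a b : ℝ} (hab : a < b) (h : ContDiffOn ℝ 1 γ (Icc a b)) :
    ∃ v, Tendsto (deriv γ) (𝓝[>] a) (𝓝 v) ∧ HasDerivWithinAt γ v (Ioi a) a := by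
  have hc := h.continuousOn_derivWithin (uniqueDiffOn_Icc hab) le_rfl
  have ha : a ∈ Icc a b := left_mem_Icc.2 hab.le
  refine ⟨derivWithin γ (Icc a b) a, ?_, ?_⟩
  · have h1 : Tendsto (derivWithin γ (Icc a b)) (𝓝[>] a) (𝓝 (derivWithin γ (Icc a b) a)) :=
      (hc a ha).mono_left (nhdsWithin_le_of_mem (Icc_mem_nhdsGT hab))
    refine h1.congr' ?_
    filter_upwards [Ioo_mem_nhdsGT hab] with x hx
    exact derivWithin_of_mem_nhds (Icc_mem_nhds hx.1 hx.2)
  · exact ((h.differentiableOn one_ne_zero a ha).hasDerivWithinAt).mono_of_mem_nhdsWithin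
      (Icc_mem_nhdsGT hab)

theorem exists_left_deriv_of_contDiffOn {E : Type*} [NormedAddCommGroup E] [NormedSpace ℝ E]
    {γ : ℝ → E} {a b : ℝ} (hab : a < b) (h : ContDiffOn ℝ 1 γ (Icc a b)) :
    ∃ v, Tendsto (deriv γ) (𝓝[<] b) (𝓝 v) ∧ HasDerivWithinAt γ v (Iio b) b := by
  have hc := h.continuousOn_derivWithin (uniqueDiffOn_Icc hab) le_rfl
  have hb : b ∈ Icc a b := right_mem_Icc.2 hab.le
  refine ⟨derivWithin γ (Icc a b) b, ?_, ?_⟩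
  · have h1 : Tendsto (derivWithin γ (Icc a b)) (𝓝[<] b) (𝓝 (derivWithin γ (Icc a b) b)) :=
      (hc b hb).mono_left (nhdsWithin_le_of_mem (Icc_mem_nhdsLT hab))
    refine h1.congr' ?_
    filter_upwards [Ioo_mem_nhdsLT hab] with x hx
    exact derivWithin_of_mem_nhds (Icc_mem_nhds hx.1 hx.2)
  · exact ((h.differentiableOn one_ne_zero b hb).hasDerivWithinAt).mono_of_mem_nhdsWithin
      (Icc_mem_nhdsLT hab)

theorem exists_fin_castSucc_le_lt {n : ℕ} (τ : Fin (n + 1) → ℝ) {t : ℝ} (h0 : τ 0 ≤ t)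
    (h1 : t < τ (Fin.last n)) : ∃ i : Fin n, τ i.castSucc ≤ t ∧ t < τ i.succ := by
  by_contra! H
  have : ∀ i : Fin (n + 1), τ i ≤ t := fun i => by
    induction i using Fin.induction with
    | zero => exact h0
    | succ i ih => exact H i ih
  exact absurd (this (Fin.last n)) (not_le.2 h1)

theorem exists_fin_castSucc_lt_le {n : ℕ} (τ : Fin (n + 1) → ℝ) {t : ℝ} (h0 : τ 0 < t)
    (h1 : t ≤ τ (Fin.last n)) : ∃ i : Fin n, τ i.castSucc < t ∧ t ≤ τ i.succ := by
  by_contra! H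
  have : ∀ i : Fin (n + 1), τ i < t := fun i => by
    induction i using Fin.induction with
    | zero => exact h0
    | succ i ih => exact H i ih
  exact absurd (this (Fin.last n)) (not_lt.2 h1)

theorem Function.Periodic.contDiffOn_translate {E : Type*} [NormedAddCommGroup E]
    [NormedSpace ℝ E] {γ : ℝ → E} {c a b : ℝ} (hp : Function.Periodic γ c)
    (h : ContDiffOn ℝ 1 γ (Icc a b)) : ContDiffOn ℝ 1 γ (Icc (a + c) (b + c)) := by
  have h1 : ContDiffOn ℝ 1 (fun x => γ (x - c)) (Icc (a + c) (b + c)) :=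
    h.comp (by fun_prop) fun x hx => ⟨by linarith [hx.1], by linarith [hx.2]⟩
  exact h1.congr fun x _ => (hp.sub_eq x).symm

namespace IsBoundaryParam

variable {Ω : Set Plane} {γ : ℝ → Plane} {L : ℝ}

/-- One vector plays both roles: as a limit of `deriv γ` it enters the tangent cone, as a one-sided
derivative it controls the distance along the curve. -/
theorem exists_right_deriv (hγ : IsBoundaryParam Ω γ L) (t : ℝ) :
    ∃ v, Tendsto (deriv γ) (𝓝[>] t) (𝓝 v) ∧ HasDerivWithinAt γ v (Ioi t) t := by
  obtain ⟨n, τ, -, h0, hL, hC⟩ := hγ.piecewiseC1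
  have hm := toIcoMod_mem_Ico hγ.length_pos 0 t
  have he := self_sub_toIcoDiv_zsmul hγ.length_pos 0 t
  set t' := toIcoMod hγ.length_pos 0 t
  set k := toIcoDiv hγ.length_pos 0 t
  obtain ⟨i, hi, hi'⟩ := exists_fin_castSucc_le_lt τ (t := t') (h0 ▸ hm.1)
    (by rw [hL]; simpa using hm.2)
  have h1 := (hγ.periodic.zsmul k).contDiffOn_translate
    ((hC i).mono (Icc_subset_Icc_left hi))
  have ht : t' + k • L = t := by rw [← he]; ring
  rw [ht] at h1
  exact exists_right_deriv_of_contDiffOn (by linarith) h1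

theorem exists_left_deriv (hγ : IsBoundaryParam Ω γ L) (t : ℝ) :
    ∃ v, Tendsto (deriv γ) (𝓝[<] t) (𝓝 v) ∧ HasDerivWithinAt γ v (Iio t) t := by
  obtain ⟨n, τ, -, h0, hL, hC⟩ := hγ.piecewiseC1
  -- The representative is taken in `(0, L]`, so that a smooth piece lies to its left even when `t`
  -- is a multiple of `L`.
  have hm := toIocMod_mem_Ioc hγ.length_pos 0 t
  have he := self_sub_toIocDiv_zsmul hγ.length_pos 0 t
  set t' := toIocMod hγ.length_pos 0 t
  set k := toIocDiv hγ.length_pos 0 t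
  obtain ⟨i, hi, hi'⟩ := exists_fin_castSucc_lt_le τ (t := t') (h0 ▸ hm.1)
    (by rw [hL]; simpa using hm.2)
  have h1 := (hγ.periodic.zsmul k).contDiffOn_translate
    ((hC i).mono (Icc_subset_Icc_right hi'))
  have ht : t' + k • L = t := by rw [← he]; ring
  rw [ht] at h1
  exact exists_left_deriv_of_contDiffOn (by linarith) h1

theorem mem_frontier (hγ : IsBoundaryParam Ω γ L) (t : ℝ) : γ t ∈ frontier Ω := by
  rw [← hγ.image_eq]
  refine ⟨toIcoMod hγ.length_pos 0 t, by simpa using toIcoMod_mem_Ico hγ.length_pos 0 t, ?_⟩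
  rw [toIcoMod, hγ.periodic.sub_zsmul_eq]

theorem exists_param (hγ : IsBoundaryParam Ω γ L) {q : Plane} (hq : q ∈ frontier Ω) (a : ℝ) :
    ∃ t ∈ Ico a (a + L), γ t = q := by
  rw [← hγ.image_eq] at hq
  obtain ⟨u, -, rfl⟩ := hq
  obtain ⟨y, hy, h⟩ := hγ.periodic.exists_mem_Ico hγ.length_pos u a
  exact ⟨y, hy, h.symm⟩

/-- Equal values force equal residues mod `L`, so `t - u` is an integer multiple of `L`, and only
the zero multiple is short enough. -/
theorem eq_of_eq (hγ : IsBoundaryParam Ω γ L) {t u : ℝ} (h : γ t = γ u) (htu : |t - u| < L) :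
    t = u := by
  have hmod : toIcoMod hγ.length_pos 0 t = toIcoMod hγ.length_pos 0 u := by
    refine hγ.injOn (by simpa using toIcoMod_mem_Ico hγ.length_pos 0 t)
      (by simpa using toIcoMod_mem_Ico hγ.length_pos 0 u) ?_
    rw [toIcoMod, toIcoMod, hγ.periodic.sub_zsmul_eq, hγ.periodic.sub_zsmul_eq, h]
  have h1 : t - u = (toIcoDiv hγ.length_pos 0 t - toIcoDiv hγ.length_pos 0 u : ℤ) * L := by
    have e1 := toIcoMod_add_toIcoDiv_zsmul hγ.length_pos 0 t
    have e2 := toIcoMod_add_toIcoDiv_zsmul hγ.length_pos 0 u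
    rw [zsmul_eq_mul] at e1 e2
    push_cast
    linarith
  set k := toIcoDiv hγ.length_pos 0 t - toIcoDiv hγ.length_pos 0 u
  rw [h1, abs_mul, abs_of_pos hγ.length_pos, mul_lt_iff_lt_one_left hγ.length_pos] at htu
  have hk : k = 0 := by
    rw [← Int.abs_lt_one_iff]
    exact_mod_cast htu
  rw [hk] at h1
  simp at h1
  linarith

end IsBoundaryParam

/-! ### Distance to the centre along the curve; entry and exit points -/

theorem HasDerivWithinAt.nonneg_of_eventually_le_right {φ : ℝ → ℝ} {d t : ℝ}
    (h : HasDerivWithinAt φ d (Ioi t) t) (hle : ∀ᶠ u in 𝓝[>] t, φ t ≤ φ u) : 0 ≤ d := by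
  rw [hasDerivWithinAt_iff_tendsto_slope' (by simp)] at h
  refine ge_of_tendsto h ?_
  filter_upwards [hle, self_mem_nhdsWithin] with u hu (htu : t < u)
  rw [slope_def_field]
  exact div_nonneg (sub_nonneg.2 hu) (sub_nonneg.2 htu.le)

theorem HasDerivWithinAt.nonpos_of_eventually_le_left {φ : ℝ → ℝ} {d t : ℝ}
    (h : HasDerivWithinAt φ d (Iio t) t) (hle : ∀ᶠ u in 𝓝[<] t, φ t ≤ φ u) : d ≤ 0 := by
  rw [hasDerivWithinAt_iff_tendsto_slope' (by simp)] at h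
  refine le_of_tendsto h ?_
  filter_upwards [hle, self_mem_nhdsWithin] with u hu (htu : u < t)
  rw [slope_def_field]
  exact div_nonpos_of_nonneg_of_nonpos (sub_nonneg.2 hu) (sub_nonpos.2 htu.le)

theorem exists_nonneg_combination_eq_zero {A B : ℝ} (h : A ≤ 0 ∧ 0 ≤ B ∨ 0 ≤ A ∧ B ≤ 0) :
    ∃ α β : ℝ, 0 ≤ α ∧ 0 ≤ β ∧ 0 < α + β ∧ α * A + β * B = 0 := by
  by_cases hA : A = 0
  · exact ⟨1, 0, by norm_num, le_rfl, by norm_num, by simp [hA]⟩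
  · refine ⟨|B|, |A|, abs_nonneg _, abs_nonneg _, ?_, ?_⟩
    · have := abs_pos.2 hA
      positivity
    · rcases h with ⟨h1, h2⟩ | ⟨h1, h2⟩
      · rw [abs_of_nonneg h2, abs_of_nonpos h1]; ring
      · rw [abs_of_nonpos h2, abs_of_nonneg h1]; ring

/-- On a tangent-cone graph-like boundary, the distance to `γ s` has no local extrema within
the disk of radius `r`, except at `γ s` itself. -/
theorem IsBoundaryParam.lt_dist_of_isLocalExtr {Ω : Set Plane} {γ : ℝ → Plane} {L r : ℝ}
    (hγ : IsBoundaryParam Ω γ L) (hT : IsTCGL Ω γ r) {s t : ℝ} (hne : γ t ≠ γ s)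
    (he : IsLocalExtr (fun u => ‖γ u - γ s‖ ^ 2) t) : r < dist (γ t) (γ s) := by
  by_contra! hle
  obtain ⟨Γp, hp, hp'⟩ := hγ.exists_right_deriv t
  obtain ⟨Γm, hm, hm'⟩ := hγ.exists_left_deriv t
  have dp := (hp'.sub_const (γ s)).norm_sq
  have dm := (hm'.sub_const (γ s)).norm_sq
  have hsign : inner ℝ Γm (γ t - γ s) ≤ 0 ∧ 0 ≤ inner ℝ Γp (γ t - γ s) ∨
      0 ≤ inner ℝ Γm (γ t - γ s) ∧ inner ℝ Γp (γ t - γ s) ≤ 0 := by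
    rw [real_inner_comm _ Γm, real_inner_comm _ Γp]
    rcases he with he | he
    · left
      have h1 := dp.nonneg_of_eventually_le_right (he.filter_mono nhdsWithin_le_nhds)
      have h2 := dm.nonpos_of_eventually_le_left (he.filter_mono nhdsWithin_le_nhds)
      exact ⟨by linarith, by linarith⟩
    · right
      have he' := he.neg
      have h1 := dp.neg.nonneg_of_eventually_le_right (he'.filter_mono nhdsWithin_le_nhds)
      have h2 := dm.neg.nonpos_of_eventually_le_left (he'.filter_mono nhdsWithin_le_nhds)
      exact ⟨by linarith, by linarith⟩
  obtain ⟨α, β, hα, hβ, hαβ, h0⟩ := exists_nonneg_combination_eq_zero hsign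
  have hr : 0 ≤ r := dist_nonneg.trans hle
  -- The condition is applied in the disk about `γ t`, which contains `γ s` by symmetry of the
  -- distance.
  refine hT t (α • Γm + β • Γp) ⟨Γm, Γp, α, β, hm, hp, hα, hβ, hαβ, rfl⟩ (γ t)
    ⟨hγ.mem_frontier t, Metric.mem_closedBall_self hr⟩ (γ s)
    ⟨hγ.mem_frontier s, by rwa [Metric.mem_closedBall, dist_comm]⟩ hne ?_
  rw [inner_add_left, real_inner_smul_left, real_inner_smul_left, h0]

theorem exists_first_eq {ρ : ℝ → ℝ} {c s t : ℝ} (hst : s ≤ t)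
    (hρ : ContinuousOn ρ (Icc s t)) (hs : ρ s < c) (ht : c < ρ t) :
    ∃ u ∈ Ioo s t, ρ u = c ∧ ∀ v ∈ Ico s u, ρ v < c := by
  have hE : IsCompact (Icc s t ∩ ρ ⁻¹' Ici c) :=
    isCompact_Icc.of_isClosed_subset (hρ.preimage_isClosed_of_isClosed isClosed_Icc isClosed_Ici)
      inter_subset_left
  have hmem := hE.sInf_mem ⟨t, right_mem_Icc.2 hst, ht.le⟩
  set u := sInf (Icc s t ∩ ρ ⁻¹' Ici c)
  have hmin : ∀ v ∈ Icc s t, c ≤ ρ v → u ≤ v := fun v hv hc =>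
    csInf_le hE.bddBelow ⟨hv, hc⟩
  have hlt : ∀ v ∈ Ico s u, ρ v < c := fun v hv => by
    by_contra! h
    exact absurd (hmin v ⟨hv.1, hv.2.le.trans hmem.1.2⟩ h) (not_le.2 hv.2)
  have hu : ρ u = c := by
    obtain ⟨v, hv, hvc⟩ := intermediate_value_Icc hmem.1.1
      (hρ.mono (Icc_subset_Icc_right hmem.1.2)) (show c ∈ Icc (ρ s) (ρ u) from ⟨hs.le, hmem.2⟩)
    have := hmin v ⟨hv.1, hv.2.trans hmem.1.2⟩ hvc.ge
    rwa [le_antisymm this hv.2]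
  refine ⟨u, ⟨lt_of_le_of_ne hmem.1.1 ?_, lt_of_le_of_ne hmem.1.2 ?_⟩, hu, hlt⟩
  · rintro h; rw [← h] at hu; exact hs.ne hu
  · rintro h; rw [h] at hu; exact ht.ne' hu

theorem exists_last_eq {ρ : ℝ → ℝ} {c s t : ℝ} (hst : t ≤ s)
    (hρ : ContinuousOn ρ (Icc t s)) (hs : ρ s < c) (ht : c < ρ t) :
    ∃ u ∈ Ioo t s, ρ u = c ∧ ∀ v ∈ Ioc u s, ρ v < c := by
  obtain ⟨u, hu, hc, h⟩ := exists_first_eq (ρ := fun x => ρ (-x)) (neg_le_neg hst)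
    (hρ.comp continuous_neg.continuousOn fun x hx => ⟨by linarith [hx.2], by linarith [hx.1]⟩)
    (by simpa using hs) (by simpa using ht)
  refine ⟨-u, ⟨by linarith [hu.2], by linarith [hu.1]⟩, hc, fun v hv => ?_⟩
  simpa using h (-v) ⟨by linarith [hv.2], by linarith [hv.1]⟩

namespace IsBoundaryParam

variable {Ω : Set Plane} {γ : ℝ → Plane} {L r : ℝ}

theorem exists_exit_params (hγ : IsBoundaryParam Ω γ L) (hr : 0 < r) (hT : IsTCGL Ω γ r) (s : ℝ) :
    ∃ sm sp, sm < s ∧ s < sp ∧ sp < sm + L ∧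
      (∀ t ∈ Icc sm sp, γ t ∈ Metric.closedBall (γ s) r) ∧
      frontier Ω ∩ Metric.sphere (γ s) r = {γ sp, γ sm} := by
  have hL := hγ.length_pos
  set ρ : ℝ → ℝ := fun u => ‖γ u - γ s‖ ^ 2 with hρdef
  have hρc : Continuous ρ := by have := hγ.continuous; fun_prop
  have hρs : ρ s = 0 := by simp [hρdef]
  have hρL : ∀ t, ρ (t + L) = ρ t := fun t => by simp only [hρdef, hγ.periodic t]
  have hne : ∀ t, t ∈ Ioo s (s + L) → γ t ≠ γ s := fun t ht h => by
    have := hγ.eq_of_eq h (by rw [abs_lt]; constructor <;> linarith [ht.1, ht.2])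
    exact ht.1.ne' this
  have hρlt : ∀ t, r < dist (γ t) (γ s) ↔ r ^ 2 < ρ t := fun t => by
    rw [dist_eq_norm, hρdef, pow_lt_pow_iff_left₀ hr.le (norm_nonneg _) two_ne_zero]
  have hρle : ∀ t, dist (γ t) (γ s) ≤ r ↔ ρ t ≤ r ^ 2 := fun t => by
    rw [← not_lt, hρlt, not_lt]
  have hρeq : ∀ t, dist (γ t) (γ s) = r ↔ ρ t = r ^ 2 := fun t => by
    rw [dist_eq_norm, hρdef, pow_left_inj₀ (norm_nonneg _) hr.le two_ne_zero]
  -- The curve leaves the disk.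
  obtain ⟨t₀, ht₀, hmax⟩ := isCompact_Icc.exists_isMaxOn
    (nonempty_Icc.2 (by linarith : s ≤ s + L)) hρc.continuousOn
  have hpos : 0 < ρ t₀ := by
    have hmid : s + L / 2 ∈ Ioo s (s + L) := ⟨by linarith, by linarith⟩
    refine lt_of_lt_of_le ?_ (hmax (Ioo_subset_Icc_self hmid))
    have := norm_pos_iff.2 (sub_ne_zero.2 (hne _ hmid))
    positivity
  have ht₀' : t₀ ∈ Ioo s (s + L) := by
    refine ⟨lt_of_le_of_ne ht₀.1 ?_, lt_of_le_of_ne ht₀.2 ?_⟩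
    · rintro h; rw [← h, hρs] at hpos; exact lt_irrefl _ hpos
    · rintro h; rw [h, hρL, hρs] at hpos; exact lt_irrefl _ hpos
  -- The farthest point is interior to the period, hence a local maximum, hence outside the disk.
  have hr0 : r ^ 2 < ρ t₀ := (hρlt _).1 (hγ.lt_dist_of_isLocalExtr hT (hne _ ht₀')
    (Or.inr (hmax.isLocalMax (Icc_mem_nhds ht₀'.1 ht₀'.2))))
  have hsr : ρ s < r ^ 2 := by rw [hρs]; positivity
  obtain ⟨sp, hsp, hsp', hspl⟩ := exists_first_eq ht₀'.1.le hρc.continuousOn hsr hr0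
  -- `t₀ - L` is the same far point one period earlier, so `sp < t₀ < sm + L`.
  obtain ⟨sm, hsm, hsm', hsml⟩ := exists_last_eq (t := t₀ - L) (by linarith [ht₀'.2])
    hρc.continuousOn hsr (by rw [← hρL]; simpa using hr0)
  have hout : ∀ t ∈ Ioo sp (sm + L), r ^ 2 < ρ t := by
    have key : ∀ t ∈ Ioo sp (sm + L), IsMinOn ρ (Icc sp (sm + L)) t → r ^ 2 < ρ t :=
      fun t ht hmin => (hρlt _).1 (hγ.lt_dist_of_isLocalExtr hT
        (hne _ ⟨hsp.1.trans ht.1, ht.2.trans (by linarith [hsm.2])⟩)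
        (Or.inl (hmin.isLocalMin (Icc_mem_nhds ht.1 ht.2))))
    intro t ht
    by_contra! hle
    obtain ⟨t₂, ht₂, hmin⟩ := isCompact_Icc.exists_isMinOn
      (nonempty_Icc.2 (ht.1.trans ht.2).le) (hρc.continuousOn (s := Icc sp (sm + L)))
    have hle₂ : ρ t₂ ≤ r ^ 2 := (hmin (Ioo_subset_Icc_self ht)).trans hle
    have heq : ρ t₂ = r ^ 2 := by
      rcases eq_or_lt_of_le ht₂.1 with h | h
      · rw [← h, hsp']
      rcases eq_or_lt_of_le ht₂.2 with h' | h'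
      · rw [h', hρL, hsm']
      exact absurd (key t₂ ⟨h, h'⟩ hmin) (not_lt.2 hle₂)
    -- The minimum over the remaining arc equals `r ^ 2`, so `t` attains it too, and `t` is
    -- interior.
    refine absurd (key t ht fun u hu => ?_) (not_lt.2 hle)
    exact hle.trans (heq ▸ hmin hu)
  refine ⟨sm, sp, hsm.2, hsp.1, by linarith [hsp.2, hsm.1], ?_, ?_⟩
  · intro t ht
    rw [Metric.mem_closedBall, hρle]
    rcases le_total t s with h | h
    · rcases eq_or_lt_of_le ht.1 with h' | h'
      · rw [← h', hsm']
      · exact (hsml t ⟨h', h⟩).le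
    · rcases eq_or_lt_of_le ht.2 with h' | h'
      · rw [h', hsp']
      · exact (hspl t ⟨h, h'⟩).le
  · ext q
    constructor
    · rintro ⟨hq, hqr⟩
      obtain ⟨t, ht, rfl⟩ := hγ.exists_param hq sm
      rw [Metric.mem_sphere, hρeq] at hqr
      rcases eq_or_lt_of_le ht.1 with h | h
      · right; rw [h]; rfl
      rcases lt_trichotomy t sp with h' | h' | h'
      · rcases le_total t s with h2 | h2
        · exact absurd hqr (hsml t ⟨h, h2⟩).ne
        · exact absurd hqr (hspl t ⟨h2, h'⟩).ne
      · left; rw [h']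
      · exact absurd hqr (hout t ⟨h', ht.2⟩).ne'
    · rintro (rfl | rfl)
      · exact ⟨hγ.mem_frontier _, (hρeq _).2 hsp'⟩
      · exact ⟨hγ.mem_frontier _, (hρeq _).2 hsm'⟩

end IsBoundaryParam

/-! ### The tangent frame -/

theorem inner_rotLeft_self (v : Plane) : inner ℝ v (rotLeft v) = 0 := by
  simp [rotLeft, PiLp.inner_apply, Fin.sum_univ_two]; ring

theorem norm_rotLeft (v : Plane) : ‖rotLeft v‖ = ‖v‖ := by
  simp [rotLeft, EuclideanSpace.norm_eq, Fin.sum_univ_two, add_comm]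

theorem IsTGLAt.eq_of_inner_eq {Ω : Set Plane} {γ : ℝ → Plane} {r s : ℝ} (h : IsTGLAt Ω γ r s)
    (hT : ‖deriv γ s‖ = 1) {u v : Plane} (hu : u ∈ frontier Ω ∩ Metric.closedBall (γ s) r)
    (hv : v ∈ frontier Ω ∩ Metric.closedBall (γ s) r)
    (huv : inner ℝ (deriv γ s) (u - γ s) = inner ℝ (deriv γ s) (v - γ s)) : u = v := by
  obtain ⟨-, A, f, hA, -⟩ := h
  rw [hA] at hu hv
  obtain ⟨x, -, rfl⟩ := hu
  obtain ⟨y, -, rfl⟩ := hv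
  have hx : ∀ x : ℝ, inner ℝ (deriv γ s)
      (γ s + x • deriv γ s + f x • rotLeft (deriv γ s) - γ s) = x := fun x => by
    rw [add_assoc, add_sub_cancel_left, inner_add_right, real_inner_smul_right,
      real_inner_smul_right, inner_rotLeft_self, real_inner_self_eq_norm_sq, hT]
    simp
  simp only [hx] at huv
  rw [huv]

/-- On the arc in the disk the tangential coordinate is continuous and, by the graph property,
injective, hence strictly monotone. Its derivative at `s` is 1, so it increases. -/
theorem IsBoundaryParam.inner_deriv_neg_pos {Ω : Set Plane} {γ : ℝ → Plane} {L r s sm sp : ℝ}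
    (hγ : IsBoundaryParam Ω γ L) (hTGL : IsTGLAt Ω γ r s) (hsm : sm < s) (hsp : s < sp)
    (hL : sp < sm + L) (hball : ∀ t ∈ Icc sm sp, γ t ∈ Metric.closedBall (γ s) r) :
    inner ℝ (deriv γ s) (γ sm - γ s) < 0 ∧ 0 < inner ℝ (deriv γ s) (γ sp - γ s) := by
  have hT := hγ.unit_speed s hTGL.1
  set x : ℝ → ℝ := fun t => inner ℝ (deriv γ s) (γ t - γ s) with hx
  have hxs : x s = 0 := by simp [hx]
  have hxc : Continuous x := by have := hγ.continuous; fun_prop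
  have hinj : InjOn x (Icc sm sp) := fun t ht u hu h =>
    hγ.eq_of_eq (hTGL.eq_of_inner_eq hT ⟨hγ.mem_frontier t, hball t ht⟩
      ⟨hγ.mem_frontier u, hball u hu⟩ h)
      (by rw [abs_lt]; constructor <;> linarith [ht.1, ht.2, hu.1, hu.2])
  have ms : s ∈ Icc sm sp := ⟨hsm.le, hsp.le⟩
  have mm : sm ∈ Icc sm sp := ⟨le_rfl, (hsm.trans hsp).le⟩
  have mp : sp ∈ Icc sm sp := ⟨(hsm.trans hsp).le, le_rfl⟩
  rcases hxc.continuousOn.strictMonoOn_of_injOn_Icc' (hsm.trans hsp).le hinj with hm | ha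
  · exact ⟨hxs ▸ hm mm ms hsm, hxs ▸ hm ms mp hsp⟩
  · exfalso
    have hd : HasDerivAt x 1 s := by
      have h1 := (hasDerivAt_const s (deriv γ s)).inner ℝ (hTGL.1.hasDerivAt.sub_const (γ s))
      simpa [hT] using h1
    have h2 := (hd.neg.hasDerivWithinAt (s := Ioi s)).nonneg_of_eventually_le_right (by
      filter_upwards [Ioo_mem_nhdsGT hsp] with u hu
      exact neg_le_neg (ha ms ⟨(hsm.trans hu.1).le, hu.2.le⟩ hu.1).le)
    linarith

/-- Away from the frontier, the interior and the exterior are disjoint open sets that cover the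
path, and a connected path stays in one of them. -/
theorem mem_interior_of_path {X : Type*} [TopologicalSpace X] {S : Set X} {c : ℝ → X} {I : Set ℝ}
    (hc : ContinuousOn c I) (hI : I.OrdConnected) (hd : ∀ u ∈ I, c u ∉ frontier S)
    {a b : ℝ} (ha : a ∈ I) (hb : b ∈ I) (haS : c a ∈ S) : c b ∈ interior S := by
  have hp : IsPreconnected (c '' I) := hI.isPreconnected.image c hc
  have hsub : c '' I ⊆ interior S ∪ (closure S)ᶜ := by
    rintro _ ⟨u, hu, rfl⟩
    by_cases h : c u ∈ closure S
    · left
      by_contra h'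
      exact hd u hu ⟨h, h'⟩
    · right; exact h
  have hdis : Disjoint (interior S) (closure S)ᶜ :=
    (disjoint_compl_right (a := closure S)).mono_left (interior_subset.trans subset_closure)
  have haI : c a ∈ interior S := by
    by_contra h'
    exact hd a ha ⟨subset_closure haS, h'⟩
  exact hp.subset_left_of_subset_union isOpen_interior isClosed_closure.isOpen_compl hdis hsub
    ⟨c a, mem_image_of_mem c ha, haI⟩ (mem_image_of_mem c hb)

/-- Cartesian coordinates with origin `p`, first axis along `T` and second axis along the left
normal of `T`. -/
noncomputable def planeFrame (p T : Plane) (z : ℝ × ℝ) : Plane := p + z.1 • T + z.2 • rotLeft T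

section Frame

variable {p T : Plane}

theorem continuous_planeFrame : Continuous (planeFrame p T) := by
  unfold planeFrame
  fun_prop

theorem inner_planeFrame (hT : ‖T‖ = 1) (z : ℝ × ℝ) :
    inner ℝ T (planeFrame p T z - p) = z.1 := by
  rw [planeFrame, add_assoc, add_sub_cancel_left, inner_add_right, real_inner_smul_right,
    real_inner_smul_right, inner_rotLeft_self, real_inner_self_eq_norm_sq, hT]
  simp

theorem inner_rotLeft_planeFrame (hT : ‖T‖ = 1) (z : ℝ × ℝ) :
    inner ℝ (rotLeft T) (planeFrame p T z - p) = z.2 := by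
  rw [planeFrame, add_assoc, add_sub_cancel_left, inner_add_right, real_inner_smul_right,
    real_inner_smul_right, real_inner_comm, inner_rotLeft_self, real_inner_self_eq_norm_sq,
    norm_rotLeft, hT]
  simp

theorem planeFrame_injective (hT : ‖T‖ = 1) : Function.Injective (planeFrame p T) :=
  fun z w h => Prod.ext (by rw [← inner_planeFrame (p := p) hT z, h, inner_planeFrame hT])
    (by rw [← inner_rotLeft_planeFrame (p := p) hT z, h, inner_rotLeft_planeFrame hT])

theorem planeFrame_inner (hT : ‖T‖ = 1) (q : Plane) :
    planeFrame p T (inner ℝ T (q - p), inner ℝ (rotLeft T) (q - p)) = q := by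
  have h : T 0 ^ 2 + T 1 ^ 2 = 1 := by
    have := EuclideanSpace.norm_sq_eq T
    rw [hT] at this
    simpa [Fin.sum_univ_two] using this.symm
  ext i
  fin_cases i
  · simp [planeFrame, rotLeft, PiLp.inner_apply, Fin.sum_univ_two]
    linear_combination (q 0 - p 0) * h
  · simp [planeFrame, rotLeft, PiLp.inner_apply, Fin.sum_univ_two]
    linear_combination (q 1 - p 1) * h

theorem norm_planeFrame_sub_sq (hT : ‖T‖ = 1) (z : ℝ × ℝ) (h : ℝ) :
    ‖planeFrame p T z - (p + h • T)‖ ^ 2 = (z.1 - h) ^ 2 + z.2 ^ 2 := by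
  have e : planeFrame p T z - (p + h • T) = (z.1 - h) • T + z.2 • rotLeft T := by
    rw [planeFrame, sub_smul]; abel
  rw [e, norm_add_sq_real, real_inner_smul_left, real_inner_smul_right, inner_rotLeft_self,
    norm_smul, norm_smul, norm_rotLeft, hT]
  simp

theorem dist_planeFrame_le_iff (hT : ‖T‖ = 1) {r : ℝ} (hr : 0 ≤ r) (z : ℝ × ℝ) (h : ℝ) :
    dist (planeFrame p T z) (p + h • T) ≤ r ↔ (z.1 - h) ^ 2 + z.2 ^ 2 ≤ r ^ 2 := by
  rw [dist_eq_norm, ← norm_planeFrame_sub_sq hT, pow_le_pow_iff_left₀ (norm_nonneg _) hr two_ne_zero]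

theorem planeFrame_mem_closedBall_iff (hT : ‖T‖ = 1) {r : ℝ} (hr : 0 ≤ r) (z : ℝ × ℝ) :
    planeFrame p T z ∈ Metric.closedBall p r ↔ z.1 ^ 2 + z.2 ^ 2 ≤ r ^ 2 := by
  simpa using dist_planeFrame_le_iff (p := p) hT hr z 0

theorem planeFrame_mem_sphere_iff (hT : ‖T‖ = 1) {r : ℝ} (hr : 0 ≤ r) (z : ℝ × ℝ) :
    planeFrame p T z ∈ Metric.sphere p r ↔ z.1 ^ 2 + z.2 ^ 2 = r ^ 2 := by
  have := norm_planeFrame_sub_sq (p := p) hT z 0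
  rw [zero_smul, add_zero, sub_zero] at this
  rw [mem_sphere_iff_norm, ← this, pow_left_inj₀ (norm_nonneg _) hr two_ne_zero]

theorem measurePreserving_planeFrame (hT : ‖T‖ = 1) : MeasurePreserving (planeFrame p T) := by
  have hon : Orthonormal ℝ ![T, rotLeft T] := by
    rw [orthonormal_iff_ite]
    intro i j
    fin_cases i <;> fin_cases j <;>
      simp [inner_rotLeft_self, real_inner_comm T, norm_rotLeft, hT]
  have hsp := hon.linearIndependent.span_eq_top_of_card_eq_finrank (by simp)
  have h1 := (OrthonormalBasis.mk hon hsp.ge).measurePreserving_repr_symm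
  have h2 := (h1.comp (PiLp.volume_preserving_toLp (Fin 2))).comp
    (volume_preserving_finTwoArrow ℝ).symm
  have h3 := (measurePreserving_add_left (volume : Measure Plane) p).comp h2
  convert! h3 using 1
  ext1 z
  simp [planeFrame, ← OrthonormalBasis.sum_repr_symm, Fin.sum_univ_two, add_assoc]

end Frame

/-! ### Which side of the boundary lies in `Ω` -/

section Sides

variable {Ω : Set Plane} {γ : ℝ → Plane} {L r s : ℝ}

theorem IsTGLAt.frame_zero_notMem_frontier (hTGL : IsTGLAt Ω γ r s) (hγ : IsBoundaryParam Ω γ L)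
    (hr : 0 < r) {y : ℝ} (hy : |y| ≤ r) (h0 : y ≠ 0) :
    planeFrame (γ s) (deriv γ s) (0, y) ∉ frontier Ω := by
  intro h
  have hT := hγ.unit_speed s hTGL.1
  have := hTGL.eq_of_inner_eq hT ⟨h, (planeFrame_mem_closedBall_iff hT hr.le _).2
    (by simpa using sq_le_sq' (abs_le.1 hy).1 (abs_le.1 hy).2)⟩
    ⟨hγ.mem_frontier s, Metric.mem_closedBall_self hr.le⟩ (by simp [inner_planeFrame hT])
  have h2 := inner_rotLeft_planeFrame (p := γ s) hT (0, y)
  rw [this] at h2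
  simp at h2
  exact h0 h2.symm

theorem IsTGLAt.frame_mem_interior (hTGL : IsTGLAt Ω γ r s) (hγ : IsBoundaryParam Ω γ L)
    (hr : 0 < r) : planeFrame (γ s) (deriv γ s) (0, r) ∈ interior Ω := by
  obtain ⟨ε, hε, hε0⟩ := ((hγ.interior_left s hTGL.1).and (Ioo_mem_nhdsGT hr)).exists
  refine mem_interior_of_path (c := fun y => planeFrame (γ s) (deriv γ s) (0, y)) (I := Ioc 0 r)
    (continuous_planeFrame.comp (by fun_prop)).continuousOn ordConnected_Ioc (fun y hy => ?_)
    (a := ε) ⟨hε0.1, hε0.2.le⟩ ⟨hr, le_rfl⟩ (interior_subset (by simpa [planeFrame] using hε))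
  exact hTGL.frame_zero_notMem_frontier hγ hr (by rw [abs_of_pos hy.1]; exact hy.2) hy.1.ne'

/-- If both poles were in `Ω`, then so would be the top and bottom edges of a small box about `γ s`,
and each point of the box off the boundary reaches one of these edges vertically without crossing
the graph. The whole box would lie in `Ω`, making the boundary point `γ s` interior. -/
theorem IsTGLAt.frame_notMem (hTGL : IsTGLAt Ω γ r s) (hγ : IsBoundaryParam Ω γ L)
    (hr : 0 < r) : planeFrame (γ s) (deriv γ s) (0, -r) ∉ Ω := by
  intro hmem
  have hT := hγ.unit_speed s hTGL.1
  have hcl : IsClosed Ω := hγ.isCompact.isClosed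
  obtain ⟨-, A, f, hA, -, hf0, hf⟩ := id hTGL
  set Φ := planeFrame (γ s) (deriv γ s) with hΦ
  have hΦc : Continuous Φ := continuous_planeFrame
  have hfr : ∀ x y : ℝ, x ^ 2 + y ^ 2 ≤ r ^ 2 → Φ (x, y) ∈ frontier Ω → x ∈ A ∧ f x = y := by
    intro x y hxy h
    have h1 : Φ (x, y) ∈ frontier Ω ∩ Metric.closedBall (γ s) r :=
      ⟨h, (planeFrame_mem_closedBall_iff hT hr.le _).2 hxy⟩
    rw [hA] at h1
    obtain ⟨x', hx', he⟩ := h1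
    have := planeFrame_injective hT (a₁ := (x', f x')) (a₂ := (x, y)) he
    rw [Prod.mk.injEq] at this
    exact ⟨this.1 ▸ hx', this.1 ▸ this.2⟩
  set δ := r / 2 with hδ
  have hδ0 : 0 < δ := by positivity
  -- Continuity of `f` at 0 keeps the graph off the edges at heights `±δ`; the choice `δ = r / 2`
  -- keeps the box in the disk.
  obtain ⟨η, hη, hηδ, hη'⟩ : ∃ η > 0, η ≤ δ ∧ ∀ x ∈ A, |x| < η → |f x| < δ := by
    have hc := hf.continuousWithinAt
    rw [Metric.continuousWithinAt_iff] at hc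
    obtain ⟨η, hη, h⟩ := hc δ hδ0
    refine ⟨min η δ, lt_min hη hδ0, min_le_right _ _, fun x hx hxη => ?_⟩
    simpa [hf0] using h hx (by simpa using hxη.trans_le (min_le_left _ _))
  have hbox : ∀ x y : ℝ, |x| < η → |y| ≤ δ → x ^ 2 + y ^ 2 ≤ r ^ 2 := by
    intro x y hx hy
    have h1 := sq_le_sq' (abs_le.1 (hx.le.trans hηδ)).1 (abs_le.1 (hx.le.trans hηδ)).2
    have h2 := sq_le_sq' (abs_le.1 hy).1 (abs_le.1 hy).2
    have : δ ^ 2 + δ ^ 2 ≤ r ^ 2 := by rw [hδ]; nlinarith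
    linarith
  have hup : Φ (0, δ) ∈ Ω := by
    refine interior_subset (mem_interior_of_path (c := fun y => Φ (0, y)) (I := Ioc 0 r)
      (hΦc.comp (by fun_prop)).continuousOn ordConnected_Ioc (fun y hy => ?_)
      (a := r) ⟨hr, le_rfl⟩ ⟨hδ0, by linarith⟩
      (interior_subset (hTGL.frame_mem_interior hγ hr)))
    exact hTGL.frame_zero_notMem_frontier hγ hr (by rw [abs_of_pos hy.1]; exact hy.2) hy.1.ne'
  have hdown : Φ (0, -δ) ∈ Ω := by
    refine interior_subset (mem_interior_of_path (c := fun y => Φ (0, y)) (I := Ico (-r) 0)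
      (hΦc.comp (by fun_prop)).continuousOn ordConnected_Ico (fun y hy => ?_)
      (a := -r) ⟨le_rfl, by linarith⟩ ⟨by linarith, by linarith⟩ hmem)
    exact hTGL.frame_zero_notMem_frontier hγ hr
      (by rw [abs_of_neg hy.2]; linarith [hy.1]) hy.2.ne
  have hhor : ∀ y : ℝ, |y| = δ → Φ (0, y) ∈ Ω → ∀ x : ℝ, |x| < η → Φ (x, y) ∈ Ω := by
    intro y hy h x hx
    refine interior_subset (mem_interior_of_path (c := fun x => Φ (x, y)) (I := Ioo (-η) η)
      (hΦc.comp (by fun_prop)).continuousOn ordConnected_Ioo (fun u hu hu' => ?_)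
      (a := 0) ⟨by linarith, hη⟩ (abs_lt.1 hx) h)
    have hu : |u| < η := abs_lt.2 hu
    obtain ⟨h1, h2⟩ := hfr u y (hbox u y hu hy.le) hu'
    have := hη' u h1 hu
    rw [h2, hy] at this
    exact lt_irrefl _ this
  have hall : ∀ x y : ℝ, |x| < η → |y| < δ → Φ (x, y) ∈ Ω := by
    intro x y hx hy
    have hy' := abs_lt.1 hy
    by_cases hb : Φ (x, y) ∈ frontier Ω
    · exact hcl.frontier_subset hb
    -- If the graph passes below the point, go up; if it passes above or misses this abscissa, go
    -- down.
    by_cases hlt : x ∈ A ∧ f x ≤ y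
    · refine interior_subset (mem_interior_of_path (c := fun v => Φ (x, v)) (I := Icc y δ)
        (hΦc.comp (by fun_prop)).continuousOn ordConnected_Icc (fun v hv hv' => ?_)
        (a := δ) ⟨hy'.2.le, le_rfl⟩ ⟨le_rfl, hy'.2.le⟩ (hhor δ (abs_of_pos hδ0) hup x hx))
      obtain ⟨-, h2⟩ := hfr x v (hbox x v hx (abs_le.2 ⟨by linarith [hv.1], hv.2⟩)) hv'
      rw [← (le_antisymm hv.1 (h2 ▸ hlt.2) : y = v)] at hv'
      exact hb hv'
    · refine interior_subset (mem_interior_of_path (c := fun v => Φ (x, v)) (I := Icc (-δ) y)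
        (hΦc.comp (by fun_prop)).continuousOn ordConnected_Icc (fun v hv hv' => ?_)
        (a := -δ) ⟨le_rfl, hy'.1.le⟩ ⟨hy'.1.le, le_rfl⟩
        (hhor (-δ) (by rw [abs_neg, abs_of_pos hδ0]) hdown x hx))
      obtain ⟨h1, h2⟩ := hfr x v (hbox x v hx (abs_le.2 ⟨hv.1, by linarith [hv.2]⟩)) hv'
      exact hlt ⟨h1, h2 ▸ hv.2⟩
  refine (hγ.mem_frontier s).2 (mem_interior_iff_mem_nhds.2 ?_)
  have c1 : ∀ᶠ q in 𝓝 (γ s), |inner ℝ (deriv γ s) (q - γ s)| < η :=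
    ContinuousAt.eventually_lt (by fun_prop) continuousAt_const (by simpa using hη)
  have c2 : ∀ᶠ q in 𝓝 (γ s), |inner ℝ (rotLeft (deriv γ s)) (q - γ s)| < δ :=
    ContinuousAt.eventually_lt (by fun_prop) continuousAt_const (by simpa using hδ0)
  filter_upwards [c1, c2] with q h1 h2
  rw [← planeFrame_inner (p := γ s) hT q]
  exact hall _ _ h1 h2

/-- A half of the circle of radius `r` about `γ s` which meets the boundary at height `y₀` only is
inside `Ω` above this height and outside `Ω` below it. -/
theorem IsTGLAt.frame_arc (hTGL : IsTGLAt Ω γ r s) (hγ : IsBoundaryParam Ω γ L) (hr : 0 < r)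
    {w : ℝ → ℝ} (hw : Continuous w) (hwr : w r = 0) (hwr' : w (-r) = 0) {y₀ : ℝ}
    (harc : ∀ y ∈ Icc (-r) r, planeFrame (γ s) (deriv γ s) (w y, y) ∈ frontier Ω → y = y₀) :
    (∀ y ∈ Ioo (-r) r, y₀ < y → planeFrame (γ s) (deriv γ s) (w y, y) ∈ interior Ω) ∧
    (∀ y ∈ Ioo (-r) r, y < y₀ → planeFrame (γ s) (deriv γ s) (w y, y) ∉ Ω) := by
  have hc : Continuous fun y => planeFrame (γ s) (deriv γ s) (w y, y) :=
    continuous_planeFrame.comp (by fun_prop)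
  constructor
  · intro y hy hlt
    refine mem_interior_of_path (c := fun y => planeFrame (γ s) (deriv γ s) (w y, y))
      (I := Icc y r) hc.continuousOn ordConnected_Icc (fun v hv hv' => ?_) (a := r)
      ⟨hy.2.le, le_rfl⟩ ⟨le_rfl, hy.2.le⟩ ?_
    · exact (hlt.trans_le hv.1).ne' (harc v ⟨hy.1.le.trans hv.1, hv.2⟩ hv')
    · simp only [hwr]
      exact interior_subset (hTGL.frame_mem_interior hγ hr)
  · intro y hy hlt hmem
    have := mem_interior_of_path (c := fun y => planeFrame (γ s) (deriv γ s) (w y, y))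
      (I := Icc (-r) y) hc.continuousOn ordConnected_Icc (fun v hv hv' => ?_) (a := y)
      (b := -r) ⟨hy.1.le, le_rfl⟩ ⟨le_rfl, hy.1.le⟩ hmem
    · simp only [hwr'] at this
      exact hTGL.frame_notMem hγ hr (interior_subset this)
    · exact (hv.2.trans_lt hlt).ne (harc v ⟨hv.1, hv.2.trans hy.2.le⟩ hv')

end Sides

/-! ### Area by horizontal slices and its derivative -/

section Slices

/-- The length of the part of `E` within distance `w` of `h`, as a function of `h`. -/
theorem hasDerivAt_integral_indicator_window {E : Set ℝ} (hE : MeasurableSet E) {w a b : ℝ}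
    (ha : E.indicator (fun _ => (1 : ℝ)) =ᶠ[𝓝 w] fun _ => a)
    (hb : E.indicator (fun _ => (1 : ℝ)) =ᶠ[𝓝 (-w)] fun _ => b) :
    HasDerivAt (fun h => ∫ x in (h - w)..(h + w), E.indicator (fun _ => (1 : ℝ)) x) (a - b) 0 := by
  set φ := E.indicator (fun _ => (1 : ℝ)) with hφ
  have hm : Measurable φ := measurable_const.indicator hE
  have hi : ∀ c d : ℝ, IntervalIntegrable φ volume c d := fun c d =>
    (intervalIntegrable_const (c := (1 : ℝ))).mono_fun hm.aestronglyMeasurable (by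
      refine ae_of_all _ fun x => ?_
      simpa using norm_indicator_le_norm_self (fun _ => (1 : ℝ)) x)
  have key : ∀ c v : ℝ, φ =ᶠ[𝓝 v] (fun _ => c) →
      HasDerivAt (fun h => ∫ x in (0 : ℝ)..(h + v), φ x) c 0 := fun c v hv => by
    have h1 := intervalIntegral.integral_hasDerivAt_right (hi 0 v)
      hm.aestronglyMeasurable.stronglyMeasurableAtFilter (continuousAt_const.congr hv.symm)
    rw [hv.self_of_nhds] at h1
    have h2 : HasDerivAt (fun u => ∫ x in (0 : ℝ)..u, φ x) c (0 + v) := by rwa [zero_add]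
    exact h2.comp_add_const 0 v
  refine ((key a w ha).sub (key b (-w) hb)).congr_of_eventuallyEq (Eventually.of_forall fun h => ?_)
  simp only [Pi.sub_apply]
  rw [intervalIntegral.integral_interval_sub_left (hi _ _) (hi _ _), sub_eq_add_neg]

/-- Both ends move at unit speed and the integrand is at most 1. The constant, independent of `w`,
is the dominating bound for differentiation under the integral. -/
theorem lipschitzWith_integral_indicator_window {E : Set ℝ} (hE : MeasurableSet E) (w : ℝ) :
    LipschitzWith 2 fun h => ∫ x in (h - w)..(h + w), E.indicator (fun _ => (1 : ℝ)) x := by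
  set φ := E.indicator (fun _ => (1 : ℝ)) with hφ
  have hm : Measurable φ := measurable_const.indicator hE
  have hle : ∀ x, ‖φ x‖ ≤ 1 := fun x => by
    simpa using norm_indicator_le_norm_self (s := E) (fun _ => (1 : ℝ)) x
  have hi : ∀ c d : ℝ, IntervalIntegrable φ volume c d := fun c d =>
    (intervalIntegrable_const (c := (1 : ℝ))).mono_fun hm.aestronglyMeasurable (by
      refine ae_of_all _ fun x => ?_
      simpa using hle x)
  refine LipschitzWith.of_dist_le_mul fun h k => ?_
  have e : (∫ x in (h - w)..(h + w), φ x) - ∫ x in (k - w)..(k + w), φ x =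
      (∫ x in (k + w)..(h + w), φ x) - ∫ x in (k - w)..(h - w), φ x := by
    have h1 := intervalIntegral.integral_add_adjacent_intervals (hi (k - w) (h - w))
      (hi (h - w) (h + w))
    have h2 := intervalIntegral.integral_add_adjacent_intervals (hi (k - w) (k + w))
      (hi (k + w) (h + w))
    linarith
  have b1 := intervalIntegral.norm_integral_le_of_norm_le_const (a := k + w) (b := h + w)
    (f := φ) (C := 1) fun x _ => hle x
  have b2 := intervalIntegral.norm_integral_le_of_norm_le_const (a := k - w) (b := h - w)
    (f := φ) (C := 1) fun x _ => hle x
  rw [add_sub_add_right_eq_sub] at b1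
  rw [sub_sub_sub_cancel_right] at b2
  rw [dist_eq_norm, e, Real.dist_eq]
  refine (norm_sub_le _ _).trans ?_
  push_cast
  linarith

variable {S : Set (ℝ × ℝ)} {r : ℝ}

theorem isClosed_diskAt (h r : ℝ) : IsClosed {z : ℝ × ℝ | (z.1 - h) ^ 2 + z.2 ^ 2 ≤ r ^ 2} :=
  isClosed_le (by fun_prop) (by fun_prop)

theorem volume_slice_inter_disk (hS : MeasurableSet S) (r h y : ℝ) :
    volume ((fun x => (x, y)) ⁻¹' (S ∩ {z : ℝ × ℝ | (z.1 - h) ^ 2 + z.2 ^ 2 ≤ r ^ 2})) =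
      ENNReal.ofReal (∫ x in (h - √(r ^ 2 - y ^ 2))..(h + √(r ^ 2 - y ^ 2)),
        ((fun x => (x, y)) ⁻¹' S).indicator (fun _ => (1 : ℝ)) x) := by
  have hE : MeasurableSet ((fun x : ℝ => (x, y)) ⁻¹' S) := measurable_prodMk_right hS
  set E := (fun x : ℝ => (x, y)) ⁻¹' S
  set w := √(r ^ 2 - y ^ 2) with hw
  have hw0 : 0 ≤ w := Real.sqrt_nonneg _
  rw [intervalIntegral.integral_of_le (by linarith), integral_indicator_const _ hE, smul_eq_mul,
    mul_one, measureReal_restrict_apply hE, ofReal_measureReal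
      ((measure_mono inter_subset_right).trans_lt measure_Ioc_lt_top).ne]
  by_cases hy : y ^ 2 ≤ r ^ 2
  · have : (fun x => (x, y)) ⁻¹' (S ∩ {z : ℝ × ℝ | (z.1 - h) ^ 2 + z.2 ^ 2 ≤ r ^ 2}) =
        E ∩ Icc (h - w) (h + w) := by
      ext x
      refine and_congr Iff.rfl ?_
      have : (x - h) ^ 2 + y ^ 2 ≤ r ^ 2 ↔ |x - h| ≤ w := by
        rw [hw, Real.le_sqrt (abs_nonneg _) (by linarith), sq_abs, le_sub_iff_add_le]
      rw [mem_Icc]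
      refine this.trans ?_
      rw [abs_le]
      constructor <;> rintro ⟨h1, h2⟩ <;> constructor <;> linarith
    rw [this]
    exact measure_congr (ae_eq_set_inter (ae_eq_refl _) Ioc_ae_eq_Icc.symm)
  -- Above and below the disk the real square root defaults to 0, so the window degenerates just as
  -- the slice is empty.
  · have h1 : w = 0 := Real.sqrt_eq_zero_of_nonpos (by linarith)
    have h2 : (fun x => (x, y)) ⁻¹' (S ∩ {z : ℝ × ℝ | (z.1 - h) ^ 2 + z.2 ^ 2 ≤ r ^ 2}) = ∅ := by
      ext x
      simp only [mem_preimage, mem_inter_iff, mem_ofPred_eq, mem_empty_iff_false, iff_false, not_and]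
      intro _ h3
      nlinarith [sq_nonneg (x - h)]
    rw [h2, h1]
    simp

theorem window_integral_nonneg (S : Set (ℝ × ℝ)) (r h y : ℝ) :
    0 ≤ ∫ x in (h - √(r ^ 2 - y ^ 2))..(h + √(r ^ 2 - y ^ 2)),
      ((fun x => (x, y)) ⁻¹' S).indicator (fun _ => (1 : ℝ)) x :=
  intervalIntegral.integral_nonneg (by linarith [Real.sqrt_nonneg (r ^ 2 - y ^ 2)])
    fun x _ => indicator_nonneg (fun _ _ => zero_le_one) x

theorem measurable_window_integral (hS : MeasurableSet S) (r h : ℝ) :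
    Measurable fun y => ∫ x in (h - √(r ^ 2 - y ^ 2))..(h + √(r ^ 2 - y ^ 2)),
      ((fun x => (x, y)) ⁻¹' S).indicator (fun _ => (1 : ℝ)) x := by
  have hm := measurable_measure_prodMk_right (μ := (volume : Measure ℝ))
    (hS.inter (isClosed_diskAt h r).measurableSet)
  simp only [volume_slice_inter_disk hS] at hm
  have := hm.ennreal_toReal
  simpa only [ENNReal.toReal_ofReal (window_integral_nonneg S r h _)] using this

theorem toReal_volume_inter_disk (hS : MeasurableSet S) (r h : ℝ) :
    (volume (S ∩ {z : ℝ × ℝ | (z.1 - h) ^ 2 + z.2 ^ 2 ≤ r ^ 2})).toReal =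
      ∫ y, ∫ x in (h - √(r ^ 2 - y ^ 2))..(h + √(r ^ 2 - y ^ 2)),
        ((fun x => (x, y)) ⁻¹' S).indicator (fun _ => (1 : ℝ)) x := by
  have hD := hS.inter (isClosed_diskAt h r).measurableSet
  rw [Measure.volume_eq_prod, Measure.prod_apply_symm hD]
  simp only [volume_slice_inter_disk hS]
  rw [integral_eq_lintegral_of_nonneg_ae (ae_of_all _ (window_integral_nonneg S r h))
    (measurable_window_integral hS r h).aestronglyMeasurable]

/-- The derivative of the area of the part of `S` in a disk moving along the first axis, when the
right half of the circle enters `S` at height `y₁` and the left half at height `y₂`. -/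
theorem hasDerivAt_volume_inter_disk (hS : MeasurableSet S) (hr : 0 < r) {y₁ y₂ : ℝ}
    (hy₁ : y₁ ∈ Ioo (-r) r) (hy₂ : y₂ ∈ Ioo (-r) r)
    (hR : ∀ y ∈ Ioo (-r) r, y₁ < y → ∀ᶠ x in 𝓝 (√(r ^ 2 - y ^ 2)), (x, y) ∈ S)
    (hR' : ∀ y ∈ Ioo (-r) r, y < y₁ → ∀ᶠ x in 𝓝 (√(r ^ 2 - y ^ 2)), (x, y) ∉ S)
    (hL : ∀ y ∈ Ioo (-r) r, y₂ < y → ∀ᶠ x in 𝓝 (-√(r ^ 2 - y ^ 2)), (x, y) ∈ S)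
    (hL' : ∀ y ∈ Ioo (-r) r, y < y₂ → ∀ᶠ x in 𝓝 (-√(r ^ 2 - y ^ 2)), (x, y) ∉ S) :
    HasDerivAt (fun h => (volume (S ∩ {z : ℝ × ℝ | (z.1 - h) ^ 2 + z.2 ^ 2 ≤ r ^ 2})).toReal)
      (y₂ - y₁) 0 := by
  set G : ℝ → ℝ → ℝ := fun h y => ∫ x in (h - √(r ^ 2 - y ^ 2))..(h + √(r ^ 2 - y ^ 2)),
        ((fun x => (x, y)) ⁻¹' S).indicator (fun _ => (1 : ℝ)) x with hG
  have hE : ∀ y, MeasurableSet ((fun x : ℝ => (x, y)) ⁻¹' S) := fun y => measurable_prodMk_right hS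
  have hGm : ∀ h, Measurable (G h) := measurable_window_integral hS r
  have hGout : ∀ h, ∀ y ∉ Ioo (-r) r, G h y = 0 := fun h y hy => by
    have : √(r ^ 2 - y ^ 2) = 0 := Real.sqrt_eq_zero_of_nonpos (by
      rw [mem_Ioo, ← abs_lt, ← sq_lt_sq₀ (abs_nonneg _) hr.le, sq_abs] at hy
      linarith)
    simp [hG, this]
  have hvol : ∀ h, (volume (S ∩ {z : ℝ × ℝ | (z.1 - h) ^ 2 + z.2 ^ 2 ≤ r ^ 2})).toReal =
      ∫ y in Ioo (-r) r, G h y := fun h => by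
    rw [toReal_volume_inter_disk hS, setIntegral_eq_integral_of_forall_compl_eq_zero (hGout h)]
  have hGint : Integrable (G 0) (volume.restrict (Ioo (-r) r)) := by
    refine Measure.integrableOn_of_bounded (M := 2 * r) measure_Ioo_lt_top.ne
      (hGm 0).aestronglyMeasurable (ae_of_all _ fun y => ?_)
    have hw : √(r ^ 2 - y ^ 2) ≤ r := Real.sqrt_le_iff.2 ⟨hr.le, by nlinarith [sq_nonneg y]⟩
    have := intervalIntegral.norm_integral_le_of_norm_le_const (a := 0 - √(r ^ 2 - y ^ 2))
      (b := 0 + √(r ^ 2 - y ^ 2)) (C := 1)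
      (f := ((fun x => (x, y)) ⁻¹' S).indicator (fun _ => (1 : ℝ))) fun x _ => by
        simpa using norm_indicator_le_norm_self (fun _ => (1 : ℝ)) x
    refine this.trans ?_
    rw [abs_of_nonneg (by linarith [Real.sqrt_nonneg (r ^ 2 - y ^ 2)])]
    linarith
  set F : ℝ → ℝ := fun y =>
    (Ioi y₁).indicator (fun _ => (1 : ℝ)) y - (Ioi y₂).indicator (fun _ => (1 : ℝ)) y with hF
  have hFm : Measurable F := (measurable_const.indicator measurableSet_Ioi).sub
    (measurable_const.indicator measurableSet_Ioi)
  have hFint : ∫ y in Ioo (-r) r, F y = y₂ - y₁ := by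
    have hi : ∀ c, Integrable ((Ioi c).indicator fun _ => (1 : ℝ))
        (volume.restrict (Ioo (-r) r)) := fun c =>
      (integrable_const (1 : ℝ)).indicator measurableSet_Ioi
    have hv : ∀ c ∈ Ioo (-r) r,
        ∫ y in Ioo (-r) r, (Ioi c).indicator (fun _ => (1 : ℝ)) y = r - c := fun c hc => by
      have hI : Ioi c ∩ Ioo (-r) r = Ioo c r := by
        ext y
        constructor
        · rintro ⟨h1, h2⟩; exact ⟨h1, h2.2⟩
        · rintro ⟨h1, h2⟩; exact ⟨h1, hc.1.trans h1, h2⟩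
      rw [integral_indicator_const _ measurableSet_Ioi, measureReal_restrict_apply measurableSet_Ioi,
        hI, Real.volume_real_Ioo_of_le hc.2.le, smul_eq_mul, mul_one]
    rw [hF, integral_sub (hi _) (hi _), hv _ hy₁, hv _ hy₂]
    ring
  -- The slices at the crossing heights `y₁` and `y₂` may fail to be differentiable, but they form a
  -- null set.
  have hne : ∀ c : ℝ, ∀ᵐ y ∂(volume.restrict (Ioo (-r) r)), y ≠ c := fun c =>
    ae_restrict_of_ae (by simp [ae_iff])
  have hdiff : ∀ᵐ y ∂(volume.restrict (Ioo (-r) r)), HasDerivAt (G · y) (F y) 0 := by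
    filter_upwards [hne y₁, hne y₂, ae_restrict_mem measurableSet_Ioo] with y h1 h2 hy
    refine hasDerivAt_integral_indicator_window (hE y) ?_ ?_
    · rcases lt_or_gt_of_ne h1 with h | h
      · filter_upwards [hR' y hy h] with x hx
        rw [indicator_of_notMem (show x ∉ (fun x => (x, y)) ⁻¹' S from hx),
          indicator_of_notMem (show y ∉ Ioi y₁ from not_lt.2 h.le)]
      · filter_upwards [hR y hy h] with x hx
        rw [indicator_of_mem (show x ∈ (fun x => (x, y)) ⁻¹' S from hx),
          indicator_of_mem (show y ∈ Ioi y₁ from h)]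
    · rcases lt_or_gt_of_ne h2 with h | h
      · filter_upwards [hL' y hy h] with x hx
        rw [indicator_of_notMem (show x ∉ (fun x => (x, y)) ⁻¹' S from hx),
          indicator_of_notMem (show y ∉ Ioi y₂ from not_lt.2 h.le)]
      · filter_upwards [hL y hy h] with x hx
        rw [indicator_of_mem (show x ∈ (fun x => (x, y)) ⁻¹' S from hx),
          indicator_of_mem (show y ∈ Ioi y₂ from h)]
  have := (hasDerivAt_integral_of_dominated_loc_of_lip (μ := volume.restrict (Ioo (-r) r))
    (F := G) (F' := F) (x₀ := (0 : ℝ)) (s := univ) (bound := fun _ => 2) univ_mem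
    (Eventually.of_forall fun h => (hGm h).aestronglyMeasurable) hGint hFm.aestronglyMeasurable
    (ae_of_all _ fun y => by
      have := lipschitzWith_integral_indicator_window (hE y) (√(r ^ 2 - y ^ 2))
      simpa [hG] using this)
    (integrable_const _) hdiff).2
  rw [hFint] at this
  exact this.congr_of_eventuallyEq (Eventually.of_forall hvol)

end Slices

/-! ### Lipschitz dependence on the centre; passage from curve to tangent line -/

theorem volume_closedBall_diff_le {r : ℝ} (hr : 0 < r) (c c' : Plane) :
    volume.real (Metric.closedBall c r \ Metric.closedBall c' r) ≤
      2 * Real.pi * r * dist c c' := by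
  set d := dist c c' with hd
  have hd0 : 0 ≤ d := dist_nonneg
  have hfin : ∀ (p : Plane) (ρ : ℝ), volume (Metric.closedBall p ρ) ≠ ⊤ := fun p ρ =>
    measure_closedBall_lt_top.ne
  have hvol : ∀ (p : Plane) (ρ : ℝ), 0 ≤ ρ →
      volume.real (Metric.closedBall p ρ) = ρ ^ 2 * Real.pi := fun p ρ hρ => by
    rw [measureReal_def, EuclideanSpace.volume_closedBall_fin_two, ENNReal.toReal_mul,
      ENNReal.toReal_pow, ENNReal.toReal_ofReal hρ, ENNReal.toReal_ofReal Real.pi_pos.le]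
  have hm := measureReal_mono (μ := (volume : Measure Plane)) (sdiff_subset
    (s := Metric.closedBall c r) (t := Metric.closedBall c' r)) (hfin c r)
  rw [hvol c r hr.le] at hm
  have hpi := Real.pi_pos
  rcases le_total r d with h | h
  · refine hm.trans ?_
    have : r * r ≤ r * d := mul_le_mul_of_nonneg_left h hr.le
    nlinarith [mul_nonneg hr.le hd0]
  -- The difference lies in an annulus of area `π (r² - (r - d)²) ≤ 2 π r d`.
  · have hsub : Metric.closedBall c (r - d) ⊆ Metric.closedBall c' r :=
      Metric.closedBall_subset_closedBall' (by linarith)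
    have hsub' : Metric.closedBall c (r - d) ⊆ Metric.closedBall c r :=
      Metric.closedBall_subset_closedBall (by linarith)
    have h1 := measureReal_mono (μ := (volume : Measure Plane))
      (sdiff_subset_sdiff_right (s := Metric.closedBall c r) hsub)
      ((measure_mono sdiff_subset).trans_lt (hfin c r).lt_top).ne
    rw [measureReal_sdiff hsub' measurableSet_closedBall (hfin _ _), hvol c r hr.le,
      hvol c _ (by linarith)] at h1
    refine h1.trans ?_
    nlinarith [mul_nonneg hpi.le (sq_nonneg d)]

theorem abs_volume_inter_closedBall_sub_le {Ω : Set Plane} {r : ℝ} (hr : 0 < r) (c c' : Plane) :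
    |(volume (Ω ∩ Metric.closedBall c r)).toReal - (volume (Ω ∩ Metric.closedBall c' r)).toReal| ≤
      2 * Real.pi * r * dist c c' := by
  have key : ∀ a b : Plane, (volume (Ω ∩ Metric.closedBall a r)).toReal -
      (volume (Ω ∩ Metric.closedBall b r)).toReal ≤ 2 * Real.pi * r * dist a b := fun a b => by
    have hsub : Ω ∩ Metric.closedBall a r ⊆
        (Ω ∩ Metric.closedBall b r) ∪ (Metric.closedBall a r \ Metric.closedBall b r) := by
      rintro x ⟨hx, hxa⟩
      by_cases h : x ∈ Metric.closedBall b r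
      · exact Or.inl ⟨hx, h⟩
      · exact Or.inr ⟨hxa, h⟩
    have hfin : ∀ a b : Plane, volume ((Ω ∩ Metric.closedBall b r) ∪
        (Metric.closedBall a r \ Metric.closedBall b r)) ≠ ⊤ := fun a b =>
      ((measure_mono (union_subset_union inter_subset_right sdiff_subset)).trans_lt
        ((measure_union_le _ _).trans_lt (ENNReal.add_lt_top.2
          ⟨measure_closedBall_lt_top, measure_closedBall_lt_top⟩))).ne
    have h1 := (measureReal_mono (μ := (volume : Measure Plane)) hsub (hfin a b)).trans
      (measureReal_union_le _ _)
    have h2 := volume_closedBall_diff_le hr a b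
    simp only [measureReal_def] at h1 h2
    linarith
  rw [abs_le]
  have h1 := key c c'
  have h2 := key c' c
  rw [dist_comm] at h2
  exact ⟨by linarith, h1⟩

/-- A Lipschitz function has the same derivative along a curve and along its tangent line. -/
theorem HasDerivAt.comp_curve_of_tangent_line {E : Type*} [NormedAddCommGroup E] [NormedSpace ℝ E]
    {V : E → ℝ} {C : ℝ} (hV : ∀ c c', |V c - V c'| ≤ C * dist c c') {γ : ℝ → E} {s D : ℝ} {T : E}
    (hγ : HasDerivAt γ T s) (hline : HasDerivAt (fun h : ℝ => V (γ s + h • T)) D 0) :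
    HasDerivAt (fun u => V (γ u)) D s := by
  rw [hasDerivAt_iff_isLittleO] at hγ
  have h2 : HasDerivAt (fun u => V (γ s + (u - s) • T)) D s :=
    HasDerivAt.comp_sub_const (f := fun h : ℝ => V (γ s + h • T)) s s (by rwa [sub_self])
  rw [hasDerivAt_iff_isLittleO] at h2 ⊢
  have h3 : (fun u => V (γ u) - V (γ s + (u - s) • T)) =o[𝓝 s] fun u => u - s := by
    refine Asymptotics.IsBigO.trans_isLittleO ?_ hγ
    refine Asymptotics.IsBigO.of_bound C (Eventually.of_forall fun u => ?_)
    refine (hV _ _).trans_eq ?_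
    rw [dist_eq_norm, sub_sub]
  refine (h3.add h2).congr_left fun u => ?_
  simp only [sub_self, zero_smul, add_zero, smul_eq_mul]
  ring

theorem volume_inter_closedBall_eq {Ω : Set Plane} (hΩ : MeasurableSet Ω) {p T : Plane}
    (hT : ‖T‖ = 1) {r : ℝ} (hr : 0 ≤ r) (h : ℝ) :
    volume (Ω ∩ Metric.closedBall (p + h • T) r) =
      volume (planeFrame p T ⁻¹' Ω ∩ {z : ℝ × ℝ | (z.1 - h) ^ 2 + z.2 ^ 2 ≤ r ^ 2}) := by
  rw [← (measurePreserving_planeFrame hT).measure_preimage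
    (hΩ.inter measurableSet_closedBall).nullMeasurableSet]
  congr 1
  ext z
  exact and_congr Iff.rfl (dist_planeFrame_le_iff hT hr z h)

/-! ### Angles and the conclusion -/

theorem exists_angle_right {r x y : ℝ} (hr : 0 < r) (hx : 0 < x) (h : x ^ 2 + y ^ 2 = r ^ 2) :
    ∃ θ ∈ Ioo (-(Real.pi / 2)) (Real.pi / 2), x = r * Real.cos θ ∧ y = r * Real.sin θ := by
  have hy : |y / r| < 1 := by
    rw [abs_div, abs_of_pos hr, div_lt_one hr]
    exact abs_lt_of_sq_lt_sq (by nlinarith) hr.le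
  obtain ⟨h1, h2⟩ := abs_lt.1 hy
  refine ⟨Real.arcsin (y / r), ⟨Real.neg_pi_div_two_lt_arcsin.2 h1, Real.arcsin_lt_pi_div_two.2 h2⟩,
    ?_, ?_⟩
  · have : 1 - (y / r) ^ 2 = (x / r) ^ 2 := by
      field_simp
      linarith
    rw [Real.cos_arcsin, this, Real.sqrt_sq (by positivity)]
    field_simp
  · rw [Real.sin_arcsin h1.le h2.le]
    field_simp

theorem exists_angle_left {r x y : ℝ} (hr : 0 < r) (hx : x < 0) (h : x ^ 2 + y ^ 2 = r ^ 2) :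
    ∃ θ ∈ Ioo (Real.pi / 2) (3 * Real.pi / 2), x = r * Real.cos θ ∧ y = r * Real.sin θ := by
  obtain ⟨θ, hθ, h1, h2⟩ := exists_angle_right (x := -x) (y := y) hr (by linarith) (by simpa using h)
  refine ⟨Real.pi - θ, ⟨by linarith [hθ.2], by linarith [hθ.1]⟩, ?_, ?_⟩
  · rw [Real.cos_pi_sub]; linarith
  · rwa [Real.sin_pi_sub]

theorem circlePoint_eq_planeFrame (γ : ℝ → Plane) (r s θ : ℝ) :
    circlePoint γ r s θ = planeFrame (γ s) (deriv γ s) (r * Real.cos θ, r * Real.sin θ) := by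
  rw [circlePoint, planeFrame, smul_add, smul_smul, smul_smul, add_assoc]

theorem mainTheorem7 (Ω : Set Plane) (γ : ℝ → Plane) (L : ℝ) (hγ : IsBoundaryParam Ω γ L)
    (r : ℝ) (hr : 0 < r) (hTCGL : IsTCGL Ω γ r)
    (s : ℝ) (hs : s ∈ Ico 0 L) (hTGL : IsTGLAt Ω γ r s) :
    ∃ sm sp θ₁ θ₂ : ℝ,
      -- entry parameter `sm` and exit parameter `sp` (for the periodic extension of `γ`)
      sm < s ∧ s < sp ∧ sp < sm + L ∧
      (∀ t ∈ Icc sm sp, γ t ∈ Metric.closedBall (γ s) r) ∧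
      frontier Ω ∩ Metric.sphere (γ s) r = {γ sp, γ sm} ∧
      -- their angles in the tangent frame
      θ₁ ∈ Ioo (-(Real.pi / 2)) (Real.pi / 2) ∧ γ sp = circlePoint γ r s θ₁ ∧
      θ₂ ∈ Ioo (Real.pi / 2) (3 * Real.pi / 2) ∧ γ sm = circlePoint γ r s θ₂ ∧
      -- the derivative, also as a difference of heights
      HasDerivAt (fun u => areaInvariant Ω γ u r) (r * Real.sin θ₂ - r * Real.sin θ₁) s ∧
      r * Real.sin θ₂ - r * Real.sin θ₁ =
        tangentHeight γ s (γ sm) - tangentHeight γ s (γ sp) := by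
  obtain ⟨sm, sp, hsm, hsp, hL, hball, hsph⟩ := hγ.exists_exit_params hr hTCGL s
  obtain ⟨hneg, hpos⟩ := hγ.inner_deriv_neg_pos hTGL hsm hsp hL hball
  have hT := hγ.unit_speed s hTGL.1
  have hΩ : IsClosed Ω := hγ.isCompact.isClosed
  set x₁ := inner ℝ (deriv γ s) (γ sp - γ s)
  set x₂ := inner ℝ (deriv γ s) (γ sm - γ s)
  set y₁ := tangentHeight γ s (γ sp)
  set y₂ := tangentHeight γ s (γ sm)
  set Φ := planeFrame (γ s) (deriv γ s)
  have e₁ : Φ (x₁, y₁) = γ sp := planeFrame_inner hT _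
  have e₂ : Φ (x₂, y₂) = γ sm := planeFrame_inner hT _
  have c₁ : x₁ ^ 2 + y₁ ^ 2 = r ^ 2 := (planeFrame_mem_sphere_iff hT hr.le (x₁, y₁)).1
    (e₁ ▸ (hsph.ge (Or.inl rfl)).2)
  have c₂ : x₂ ^ 2 + y₂ ^ 2 = r ^ 2 := (planeFrame_mem_sphere_iff hT hr.le (x₂, y₂)).1
    (e₂ ▸ (hsph.ge (Or.inr rfl)).2)
  obtain ⟨θ₁, hθ₁, hx₁, hy₁⟩ := exists_angle_right hr hpos c₁
  obtain ⟨θ₂, hθ₂, hx₂, hy₂⟩ := exists_angle_left hr hneg c₂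
  refine ⟨sm, sp, θ₁, θ₂, hsm, hsp, hL, hball, hsph, hθ₁, ?_, hθ₂, ?_, ?_, by rw [← hy₁, ← hy₂]⟩
  · rw [circlePoint_eq_planeFrame, ← hx₁, ← hy₁, ← e₁]
  · rw [circlePoint_eq_planeFrame, ← hx₂, ← hy₂, ← e₂]
  rw [← hy₁, ← hy₂]
  have hcirc : ∀ x y : ℝ, x ^ 2 + y ^ 2 = r ^ 2 → Φ (x, y) ∈ frontier Ω →
      x = x₁ ∧ y = y₁ ∨ x = x₂ ∧ y = y₂ := fun x y hxy h => by
    have hmem : Φ (x, y) ∈ ({γ sp, γ sm} : Set Plane) :=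
      hsph ▸ ⟨h, (planeFrame_mem_sphere_iff hT hr.le _).2 hxy⟩
    rw [← e₁, ← e₂] at hmem
    rcases hmem with h | h
    · exact Or.inl (Prod.mk.inj (planeFrame_injective hT h))
    · exact Or.inr (Prod.mk.inj (planeFrame_injective hT h))
  have hsq : ∀ y ∈ Icc (-r) r, √(r ^ 2 - y ^ 2) ^ 2 + y ^ 2 = r ^ 2 := fun y hy => by
    rw [Real.sq_sqrt (sub_nonneg.2 (sq_le_sq' hy.1 hy.2)), sub_add_cancel]
  have hwc : Continuous fun y : ℝ => √(r ^ 2 - y ^ 2) := by fun_prop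
  -- The right half-circle is parametrized by height; the entry point is not on it because `x₂ < 0`.
  obtain ⟨hR, hR'⟩ := hTGL.frame_arc hγ hr (w := fun y => √(r ^ 2 - y ^ 2)) (y₀ := y₁)
    hwc (by simp) (by simp) fun y hy h => by
      rcases hcirc _ y (hsq y hy) h with h | h
      · exact h.2
      · exact absurd (h.1 ▸ Real.sqrt_nonneg _) (not_le.2 hneg)
  obtain ⟨hLe, hLe'⟩ := hTGL.frame_arc hγ hr (w := fun y => -√(r ^ 2 - y ^ 2)) (y₀ := y₂)
    hwc.neg (by simp) (by simp) fun y hy h => by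
      rcases hcirc _ y (by rw [neg_sq, hsq y hy]) h with h | h
      · exact absurd (h.1 ▸ neg_nonpos.2 (Real.sqrt_nonneg _)) (not_le.2 hpos)
      · exact h.2
  have hslice : ∀ y : ℝ, Continuous fun x : ℝ => Φ (x, y) := fun y =>
    continuous_planeFrame.comp (by fun_prop)
  -- Slicewise differentiation needs membership to be locally constant at the window's ends, which
  -- openness of the interior and of the complement provides.
  have hin : ∀ x y : ℝ, Φ (x, y) ∈ interior Ω → ∀ᶠ u in 𝓝 x, (u, y) ∈ Φ ⁻¹' Ω := fun x y h =>
    ((hslice y).continuousAt.eventually (isOpen_interior.mem_nhds h)).mono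
      fun u hu => (interior_subset hu : Φ (u, y) ∈ Ω)
  have hnotin : ∀ x y : ℝ, Φ (x, y) ∉ Ω → ∀ᶠ u in 𝓝 x, (u, y) ∉ Φ ⁻¹' Ω := fun x y h =>
    (hslice y).continuousAt.eventually (hΩ.isOpen_compl.mem_nhds h)
  have hline := hasDerivAt_volume_inter_disk (S := Φ ⁻¹' Ω)
    (continuous_planeFrame.measurable hΩ.measurableSet) hr (y₁ := y₁) (y₂ := y₂)
    (abs_lt.1 (abs_lt_of_sq_lt_sq (by nlinarith) hr.le))
    (abs_lt.1 (abs_lt_of_sq_lt_sq (by nlinarith) hr.le))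
    (fun y hy h => hin _ y (hR y hy h)) (fun y hy h => hnotin _ y (hR' y hy h))
    (fun y hy h => hin _ y (hLe y hy h)) (fun y hy h => hnotin _ y (hLe' y hy h))
  refine HasDerivAt.comp_curve_of_tangent_line
    (V := fun c => (volume (Ω ∩ Metric.closedBall c r)).toReal)
    (abs_volume_inter_closedBall_sub_le hr) hTGL.1.hasDerivAt ?_
  simpa only [volume_inter_closedBall_eq hΩ.measurableSet hT hr.le] using hline
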